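/- Conventions. A concept class $\mathcal C$ over $\{0,1\}^n$ is a set of functions $c:\{0,1\}^n\to\{0,1\}$; $\mathrm{VC\text{-}dim}(\mathcal C)$ is the size of a largest $S\subseteq\{0,1\}^n$ that $\mathcal C$ shatters, i.e. on which every labelling $S\to\{0,1\}$ is the restriction of some $c\in\mathcal C$. For a probability distribution $D$ on $\{0,1\}^n$, put $\mathrm{err}_D(h,c)=\Pr_{x\sim D}[h(x)\ne c(x)]$. For a noise rate $\eta$, the $\eta$-noisy quantum example for $(c,D)$ is the $(n+1)$-qubit state $$\sum_{x\in\{0,1\}^n}\sqrt{(1-\eta)D(x)}\,|x,c(x)\rangle+\sqrt{\eta D(x)}\,|x,1-c(x)\rangle .$$ A quantum learner, possibly using internal randomness, takes a number of copies of this state and applies to them a POVM, each outcome of which is associated with a hypothesis $h:\{0,1\}^n\to\{0,1\}$ (not necessarily in $\mathcal C$); its sample complexity is the maximal number of copies it uses. It is an $(\varepsilon,\delta)$-PAC quantum learner for $\mathcal C$ with random classification noise rate $\eta$ if, for every $c\in\mathcal C$ and every distribution $D$, given copies of the $\eta$-noisy quantum example for $(c,D)$, it outputs with probability at least $1-\delta$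 an $h$ with $\mathrm{err}_D(h,c)\le\varepsilon$. Theorem. There are a universal constant $K>0$ and an integer $d_0$ such that the following holds for every $d\ge d_0$, every $n$, and every concept class $\mathcal C$ over $\{0,1\}^n$ with $\mathrm{VC\text{-}dim}(\mathcal C)=d+1$. For all $\delta\in(0,1/2)$, $\varepsilon\in(0,1/20)$ and $\eta\in(0,1/2)$, every $(\varepsilon,\delta)$-PAC quantum learner for $\mathcal C$ with random classification noise rate $\eta$ has sample complexity at least $$K\left(\frac{d}{(1-2\eta)^2\varepsilon}+\frac{\log_2(1/\delta)}{(1-2\eta)^2\varepsilon}\right).$$ -/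

import Mathlib

open scoped ComplexOrder

noncomputable section

namespace QuantumPAC

/-- The domain `{0,1}^n`. -/
abbrev Input (n : ℕ) : Type := Fin n → Bool

/-- Concepts (and hypotheses) `{0,1}^n → {0,1}`. -/
abbrev Concept (n : ℕ) : Type := Input n → Bool

/-- Computational basis states `(x, b) ∈ {0,1}^{n+1}` of an example. -/
abbrev Example (n : ℕ) : Type := Input n × Bool

/-- The VC dimension of a concept class, each concept `c` being identified with the set
`{x | c x = 1}`: the size of a largest set `S` such that every subset of `S` is `S ∩ {x | c x = 1}`
for some concept `c` of the class. -/
def vcDim {n : ℕ} (C : Finset (Concept n)) : ℕ :=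
  (C.image fun c => Finset.univ.filter fun x => c x = true).vcDim

/-- `err_D(h, c) = Pr_{x ∼ D}[h x ≠ c x]`. -/
def err {n : ℕ} (D : Input n → ℝ) (h c : Concept n) : ℝ :=
  ∑ x with h x ≠ c x, D x

/-- Amplitudes of the `η`-noisy quantum example
`∑ x, √((1-η) D(x)) |x, c(x)⟩ + √(η D(x)) |x, 1-c(x)⟩`. -/
def noisyExample {n : ℕ} (η : ℝ) (D : Input n → ℝ) (c : Concept n) : Example n → ℂ :=
  fun z => if z.2 = c z.1 then (√((1 - η) * D z.1) : ℝ) else (√(η * D z.1) : ℝ)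

/-- Amplitudes of the `T`-fold tensor power of a pure state. -/
def tensorPower {κ : Type*} (T : ℕ) (ψ : κ → ℂ) : (Fin T → κ) → ℂ :=
  fun z => ∏ i, ψ (z i)

/-- The density matrix `|ψ⟩⟨ψ|` of a pure state. -/
def density {ι : Type*} (ψ : ι → ℂ) : Matrix ι ι ℂ :=
  Matrix.vecMulVec ψ (star ψ)

/-- An `m`-outcome positive-operator-valued measure on the Hilbert space with basis `ι`. -/
structure POVM (ι : Type*) [Fintype ι] [DecidableEq ι] (m : ℕ) where
  op : Fin m → Matrix ι ι ℂ
  posSemidef : ∀ j, (op j).PosSemidef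
  sum_eq_one : ∑ j, op j = 1

/-- The probability `Tr(M_j ρ)` of the `j`-th outcome. -/
def POVM.prob {ι : Type*} [Fintype ι] [DecidableEq ι] {m : ℕ} (M : POVM ι m)
    (ρ : Matrix ι ι ℂ) (j : Fin m) : ℝ :=
  (Matrix.trace (M.op j * ρ)).re

/-- A quantum learner. Its internal randomness is a seed drawn from a finite probability
distribution. Given the seed `r` it asks for `numExamples r` examples and applies a POVM to
them jointly, each outcome of which is associated with a hypothesis. -/
structure Learner (n : ℕ) where
  numSeeds : ℕ
  seedProb : Fin numSeeds → ℝ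
  seedProb_mem : seedProb ∈ stdSimplex ℝ (Fin numSeeds)
  numExamples : Fin numSeeds → ℕ
  numOutcomes : Fin numSeeds → ℕ
  povm : ∀ r, POVM (Fin (numExamples r) → Example n) (numOutcomes r)
  hypothesis : ∀ r, Fin (numOutcomes r) → Concept n

/-- The maximal number of examples used, over the learner's internal randomness. -/
def Learner.sampleComplexity {n : ℕ} (L : Learner n) : ℕ :=
  (Finset.univ.filter fun r => 0 < L.seedProb r).sup L.numExamples

/-- The probability that the learner outputs an `h` with `err_D(h, c) ≤ ε` when every example is
the state `ψ`. -/
def Learner.successProb {n : ℕ} (L : Learner n) (ψ : Example n → ℂ) (D : Input n → ℝ)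
    (c : Concept n) (ε : ℝ) : ℝ :=
  ∑ r, L.seedProb r * ∑ j with err D (L.hypothesis r j) c ≤ ε,
    (L.povm r).prob (density (tensorPower (L.numExamples r) ψ)) j

/-- `L` is an `(ε, δ)`-PAC quantum learner for `C` under random classification noise of
rate `η`. -/
def Learner.IsNoisyPAC {n : ℕ} (L : Learner n) (C : Finset (Concept n)) (ε δ η : ℝ) : Prop :=
  ∀ c ∈ C, ∀ D ∈ stdSimplex ℝ (Input n),
    1 - δ ≤ L.successProb (noisyExample η D c) D c ε

end QuantumPAC

end

/-! The two terms of the bound are proved separately. Write `u = (1 - 2η)²` and let `T` be the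
sample complexity.

Confidence: two concepts that differ at one point of weight `2ε` have no common `ε`-approximation.
Their noisy examples overlap by at least `1 - 2εu`, so `T` copies overlap by at least `(1 - 2εu)^T`.
A measurement with error `δ` on both forces this to be at most `2√δ`
(`Learner.IsNoisyPAC.one_sub_pow_le`), whence `log (1/δ) ≤ 16uεT` for small `δ`.

Dimension: put weight `1 - 20ε` on one shattered point with a known label and spread `20ε` evenly
over the other `d`. Learning then means recovering a string `b` of `d` bits up to `d/20` errors. In
the rotated label basis only the `|0⟩ - |1⟩` component depends on `b`, through a sign, and over the
unknown points these components have total weight at most `10uε`. Expand `T` copies into words of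
components. By Markov, words with more than `d/20` signed letters have total weight at most
`200uεT/d`. The other words depend on `b` only through parities of at most `d/20` bits, so that part
lies in a span of few fixed vectors and identifies few strings. `sum_sum_prob_le` makes this
quantitative: the average success is at most `1/4 + 400uεT/d`, while it must be at least `1/2`. -/

namespace QuantumPAC

open Finset

/-! ### Measurements of pure states. -/

section Measurement

open scoped MatrixOrder

variable {ι : Type*} [Fintype ι]

/-- Measurement operators of a POVM: the outcome probabilities of a pure state are the squared
norms of its images, and the images preserve inner products in total. -/
theorem POVM.exists_measurementOperators [DecidableEq ι] {m : ℕ} (M : POVM ι m) :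
    ∃ B : Fin m → Matrix ι ι ℂ,
      (∀ v j, M.prob (density v) j = ∑ k, ‖(B j).mulVec v k‖ ^ 2) ∧
      ∀ v w : ι → ℂ, ∑ j, ∑ k, star ((B j).mulVec v k) * (B j).mulVec w k
        = ∑ z, star (v z) * w z := by
  have h : ∀ j, ∃ B : Matrix ι ι ℂ, M.op j = B.conjTranspose * B := fun j =>
    CStarAlgebra.nonneg_iff_eq_star_mul_self.mp (Matrix.nonneg_iff_posSemidef.mpr (M.posSemidef j))
  choose B hB using h
  have key : ∀ (j : Fin m) (v w : ι → ℂ),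
      star v ⬝ᵥ (M.op j).mulVec w = ∑ k, star ((B j).mulVec v k) * (B j).mulVec w k := by
    intro j v w
    rw [hB, ← Matrix.mulVec_mulVec, Matrix.dotProduct_mulVec, ← Matrix.star_mulVec]
    rfl
  refine ⟨B, fun v j => ?_, fun v w => ?_⟩
  · have h1 : Matrix.trace (M.op j * density v) = star v ⬝ᵥ (M.op j).mulVec v := by
      rw [density, Matrix.mul_vecMulVec, Matrix.trace_vecMulVec, dotProduct_comm]
    rw [POVM.prob, h1, key, Complex.re_sum]
    refine sum_congr rfl fun k _ => ?_
    rw [← Complex.normSq_eq_norm_sq, Complex.star_def, ← Complex.normSq_eq_conj_mul_self,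
      Complex.ofReal_re]
  · simp_rw [← key]
    rw [← dotProduct_sum, ← Matrix.sum_mulVec, M.sum_eq_one, Matrix.one_mulVec]
    rfl

theorem norm_sum_sq_le {β : Type*} (F : Finset β) (f : β → ℂ) :
    ‖∑ s ∈ F, f s‖ ^ 2 ≤ #F * ∑ s ∈ F, ‖f s‖ ^ 2 :=
  (pow_le_pow_left₀ (norm_nonneg _) (norm_sum_le _ _) 2).trans sq_sum_le_card_mul_sum_sq

/-- Cauchy-Schwarz makes the right side independent of the phases `a`, which will carry the unknown
string. The lost factor `#F` is affordable because `#F ^ 2` stays well below `2 ^ d`. -/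
theorem sum_norm_sq_mulVec_sum_le {β : Type*} (B : Matrix ι ι ℂ) (F : Finset β) (a : β → ℂ)
    (ha : ∀ s, ‖a s‖ = 1) (v : β → ι → ℂ) :
    ∑ k, ‖B.mulVec (∑ s ∈ F, a s • v s) k‖ ^ 2
      ≤ #F * ∑ s ∈ F, ∑ k, ‖B.mulVec (v s) k‖ ^ 2 := by
  rw [sum_comm, mul_sum]
  refine sum_le_sum fun k _ => ?_
  rw [Matrix.mulVec_sum, Finset.sum_apply]
  refine (norm_sum_sq_le F _).trans_eq ?_
  simp [Matrix.mulVec_smul, ha]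

theorem sum_norm_sq_mulVec_add_le (B : Matrix ι ι ℂ) (v w : ι → ℂ) :
    ∑ k, ‖B.mulVec (v + w) k‖ ^ 2
      ≤ 2 * ∑ k, ‖B.mulVec v k‖ ^ 2 + 2 * ∑ k, ‖B.mulVec w k‖ ^ 2 := by
  rw [mul_sum, mul_sum, ← sum_add_distrib]
  refine sum_le_sum fun k _ => ?_
  rw [Matrix.mulVec_add, Pi.add_apply]
  have := norm_add_le (B.mulVec v k) (B.mulVec w k)
  nlinarith [norm_nonneg (B.mulVec v k + B.mulVec w k),
    sq_nonneg (‖B.mulVec v k‖ - ‖B.mulVec w k‖)]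

theorem sum_norm_sq_of_sum_star_mul {m : ℕ} {B : Fin m → Matrix ι ι ℂ}
    (hB : ∀ v w : ι → ℂ, ∑ j, ∑ k, star ((B j).mulVec v k) * (B j).mulVec w k
      = ∑ z, star (v z) * w z) (v : ι → ℂ) :
    ∑ j, ∑ k, ‖(B j).mulVec v k‖ ^ 2 = ∑ z, ‖v z‖ ^ 2 := by
  have := hB v v
  simp only [Complex.star_def, Complex.conj_mul'] at this
  exact_mod_cast this

/-- Two hypotheses about a pure state that are excluded by disjoint sets of outcomes: the overlap
of the states is at most the AM-GM bound in the error probabilities. -/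
theorem POVM.norm_overlap_le [DecidableEq ι] {m : ℕ} (M : POVM ι m) {v w : ι → ℂ}
    (hv : ∑ z, ‖v z‖ ^ 2 = 1) (hw : ∑ z, ‖w z‖ ^ 2 = 1) {A A' : Finset (Fin m)}
    (hA : Disjoint A A') {t : ℝ} (ht : 0 < t) :
    ‖∑ z, star (v z) * w z‖ ≤ t + ((1 - ∑ j ∈ A, M.prob (density v) j)
      + (1 - ∑ j ∈ A', M.prob (density w) j)) / (2 * t) := by
  obtain ⟨B, hp, hB⟩ := M.exists_measurementOperators
  have hv' := sum_norm_sq_of_sum_star_mul hB v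
  have hw' := sum_norm_sq_of_sum_star_mul hB w
  simp_rw [← hp] at hv' hw'
  rw [hv] at hv'
  rw [hw] at hw'
  have hnn : ∀ u j, 0 ≤ M.prob (density u) j := fun u j => by rw [hp]; positivity
  have amgm : ∀ x y : ℝ, x * y ≤ t / 2 * x ^ 2 + 1 / (2 * t) * y ^ 2 := by
    intro x y
    have : t / 2 * x ^ 2 + 1 / (2 * t) * y ^ 2 - x * y = (t * x - y) ^ 2 / (2 * t) := by
      field_simp; ring
    have h2 : 0 ≤ (t * x - y) ^ 2 / (2 * t) := by positivity
    linarith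
  have b1 : ∀ j, ‖∑ k, star ((B j).mulVec v k) * (B j).mulVec w k‖
      ≤ t / 2 * M.prob (density v) j + 1 / (2 * t) * M.prob (density w) j := by
    intro j
    rw [hp, hp, mul_sum, mul_sum, ← sum_add_distrib]
    refine (norm_sum_le _ _).trans (sum_le_sum fun k _ => ?_)
    rw [norm_mul, norm_star]
    exact amgm _ _
  have b2 : ∀ j, ‖∑ k, star ((B j).mulVec v k) * (B j).mulVec w k‖
      ≤ t / 2 * M.prob (density w) j + 1 / (2 * t) * M.prob (density v) j := by
    intro j
    rw [hp, hp, mul_sum, mul_sum, ← sum_add_distrib]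
    refine (norm_sum_le _ _).trans (sum_le_sum fun k _ => ?_)
    rw [norm_mul, norm_star, mul_comm]
    exact amgm _ _
  have split : ∀ u, ∑ j, M.prob (density u) j
      = ∑ j ∈ A, M.prob (density u) j + ∑ j ∈ Aᶜ, M.prob (density u) j := fun u =>
    (sum_add_sum_compl A _).symm
  -- `A'` lies inside `Aᶜ`, so `w` is rarely seen on `A` and `v` is rarely seen on `Aᶜ`.
  have hsub : ∑ j ∈ A', M.prob (density w) j ≤ ∑ j ∈ Aᶜ, M.prob (density w) j :=
    sum_le_sum_of_subset_of_nonneg (fun j hj => by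
      rw [mem_compl]; exact fun h => disjoint_left.mp hA h hj) fun j _ _ => hnn w j
  have sv := split v
  have sw := split w
  rw [hv'] at sv
  rw [hw'] at sw
  have hAv : ∑ j ∈ A, M.prob (density v) j ≤ 1 := by
    have := sum_nonneg fun j (_ : j ∈ Aᶜ) => hnn v j
    linarith
  have hAw : ∑ j ∈ Aᶜ, M.prob (density w) j ≤ 1 := by
    have := sum_nonneg fun j (_ : j ∈ A) => hnn w j
    linarith
  rw [← hB v w]
  refine (norm_sum_le _ _).trans ?_
  -- On each half the large AM-GM weight `1 / (2 * t)` is given to the state that is unlikely there.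
  rw [← sum_add_sum_compl A]
  refine (add_le_add (sum_le_sum fun j _ => b1 j) (sum_le_sum fun j _ => b2 j)).trans ?_
  rw [sum_add_distrib, sum_add_distrib, ← mul_sum, ← mul_sum, ← mul_sum, ← mul_sum]
  have e1 : ((1 - ∑ j ∈ A, M.prob (density v) j)
      + (1 - ∑ j ∈ A', M.prob (density w) j)) / (2 * t)
      = 1 / (2 * t) * (1 - ∑ j ∈ A, M.prob (density v) j)
        + 1 / (2 * t) * (1 - ∑ j ∈ A', M.prob (density w) j) := by ring
  rw [e1]
  have hpos : 0 ≤ 1 / (2 * t) := by positivity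
  have i1 := mul_le_mul_of_nonneg_left
    (show ∑ j ∈ A, M.prob (density w) j ≤ 1 - ∑ j ∈ A', M.prob (density w) j by linarith) hpos
  have i2 := mul_le_mul_of_nonneg_left
    (show ∑ j ∈ Aᶜ, M.prob (density v) j ≤ 1 - ∑ j ∈ A, M.prob (density v) j by linarith) hpos
  have i3 := mul_le_mul_of_nonneg_left hAv (show 0 ≤ t / 2 by positivity)
  have i4 := mul_le_mul_of_nonneg_left hAw (show 0 ≤ t / 2 by positivity)
  linarith

end Measurement

/-! ### Tensor powers and words of orthogonal components. -/

section Tensor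

variable {ι κ : Type*}

theorem sum_star_tensorPower_mul [Fintype ι] {T : ℕ} (v w : ι → ℂ) :
    ∑ z, star (tensorPower T v z) * tensorPower T w z = (∑ z, star (v z) * w z) ^ T := by
  classical
  simp only [tensorPower, star_prod, ← prod_mul_distrib]
  rw [← Fintype.piFinset_univ, ← prod_univ_sum (fun _ => univ) fun _ z => star (v z) * w z]
  simp

theorem sum_norm_sq_tensorPower [Fintype ι] {T : ℕ} {v : ι → ℂ} (hv : ∑ z, ‖v z‖ ^ 2 = 1) :
    ∑ z, ‖tensorPower T v z‖ ^ 2 = 1 := by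
  have h := sum_star_tensorPower_mul (T := T) v v
  simp only [Complex.star_def, Complex.conj_mul'] at h
  have h2 : ∑ z, ‖tensorPower T v z‖ ^ 2 = (∑ z, ‖v z‖ ^ 2) ^ T := by exact_mod_cast h
  rw [h2, hv, one_pow]

/-- Pythagoras for combinations of products of orthogonal vectors. -/
theorem sum_norm_sq_sum_prod [Fintype ι] {T : ℕ} {e : κ → ι → ℂ} {p : κ → ℝ}
    (he : ∀ l l', l ≠ l' → ∑ z, star (e l z) * e l' z = 0)
    (hp : ∀ l, ∑ z, ‖e l z‖ ^ 2 = p l) (W : Finset (Fin T → κ)) (a : (Fin T → κ) → ℂ)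
    (ha : ∀ w, ‖a w‖ = 1) :
    ∑ z : Fin T → ι, ‖(∑ w ∈ W, a w • fun z : Fin T → ι => ∏ i, e (w i) (z i)) z‖ ^ 2
      = ∑ w ∈ W, ∏ i, p (w i) := by
  classical
  have hin : ∀ w w' : Fin T → κ,
      ∑ z : Fin T → ι, star (∏ i, e (w i) (z i)) * ∏ i, e (w' i) (z i)
        = ∏ i, ∑ z, star (e (w i) z) * e (w' i) z := by
    intro w w'
    simp only [star_prod, ← prod_mul_distrib]
    rw [← Fintype.piFinset_univ,
      ← prod_univ_sum (fun _ => univ) fun i z => star (e (w i) z) * e (w' i) z]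
  have hC : ∑ z : Fin T → ι,
      star ((∑ w ∈ W, a w • fun z : Fin T → ι => ∏ i, e (w i) (z i)) z)
        * (∑ w ∈ W, a w • fun z : Fin T → ι => ∏ i, e (w i) (z i)) z
      = ∑ w ∈ W, ∏ i, (p (w i) : ℂ) := by
    have : ∀ z : Fin T → ι,
        star ((∑ w ∈ W, a w • fun z : Fin T → ι => ∏ i, e (w i) (z i)) z)
          * (∑ w ∈ W, a w • fun z : Fin T → ι => ∏ i, e (w i) (z i)) z
        = ∑ w ∈ W, ∑ w' ∈ W, star (a w) * a w' *
            (star (∏ i, e (w i) (z i)) * ∏ i, e (w' i) (z i)) := by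
      intro z
      simp only [Finset.sum_apply, Pi.smul_apply, smul_eq_mul, star_sum, star_mul', sum_mul_sum]
      refine sum_congr rfl fun w _ => sum_congr rfl fun w' _ => by ring
    simp_rw [this]
    rw [sum_comm]
    refine sum_congr rfl fun w hw => ?_
    rw [sum_comm]
    simp_rw [← mul_sum, hin]
    rw [sum_eq_single_of_mem w hw]
    · rw [Complex.star_def, Complex.conj_mul', ha]
      simp only [Complex.ofReal_one, one_pow, one_mul]
      refine prod_congr rfl fun i _ => ?_
      rw [← hp]
      push_cast
      exact sum_congr rfl fun z _ => by rw [Complex.conj_mul']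
    · intro w' _ hne
      obtain ⟨i, hi⟩ := Function.ne_iff.mp hne
      rw [prod_eq_zero (mem_univ i) (he _ _ (Ne.symm hi)), mul_zero]
  simp only [Complex.star_def, Complex.conj_mul'] at hC
  exact_mod_cast hC

theorem tensorPower_sum [Fintype κ] {T : ℕ} (a : κ → ℂ) (e : κ → ι → ℂ) :
    tensorPower T (∑ l, a l • e l)
      = ∑ w : Fin T → κ, (∏ i, a (w i)) • fun z : Fin T → ι => ∏ i, e (w i) (z i) := by
  classical
  ext z
  simp only [tensorPower, Finset.sum_apply, Pi.smul_apply, smul_eq_mul, ← prod_mul_distrib]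
  rw [prod_univ_sum (fun _ => univ) fun i l => a l * e l (z i), Fintype.piFinset_univ]

/-- Markov's inequality for the number of letters with a property in a random word. -/
theorem sum_prod_filter_le [Fintype κ] {T : ℕ} {p : κ → ℝ} (hp : ∀ l, 0 ≤ p l) (hp1 : ∑ l, p l = 1)
    (P : κ → Prop) [DecidablePred P] {s : ℝ} (hs : 0 < s) :
    ∑ w : Fin T → κ with s < #{i | P (w i)}, ∏ i, p (w i)
      ≤ T * (∑ l with P l, p l) / s := by
  classical
  have hw : ∀ w : Fin T → κ, 0 ≤ ∏ i, p (w i) := fun w => prod_nonneg fun i _ => hp _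
  rw [le_div_iff₀ hs, sum_mul]
  have mean : ∀ i : Fin T, ∑ w : Fin T → κ, (if P (w i) then ∏ j, p (w j) else 0)
      = ∑ l with P l, p l := by
    intro i
    -- With the indicator moved into the `i`-th factor the sum over words factorises, and every
    -- other factor sums to `1`.
    have h1 : ∀ w : Fin T → κ, (if P (w i) then ∏ j, p (w j) else 0)
        = ∏ j, (if j = i then (if P (w j) then p (w j) else 0) else p (w j)) := by
      intro w
      split_ifs with h
      · refine prod_congr rfl fun j _ => ?_
        by_cases hj : j = i
        · subst hj; simp [h]
        · simp [hj]
      · exact (prod_eq_zero (mem_univ i) (by simp [h])).symm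
    simp_rw [h1]
    rw [← Fintype.piFinset_univ, ← prod_univ_sum (fun _ => univ)
      fun j l => if j = i then (if P l then p l else 0) else p l]
    rw [prod_eq_single i]
    · simp [sum_filter]
    · intro j _ hj
      simp [hj, hp1]
    · simp
  calc ∑ w : Fin T → κ with s < #{i | P (w i)}, (∏ i, p (w i)) * s
      ≤ ∑ w : Fin T → κ with s < #{i | P (w i)}, (#{i | P (w i)} : ℝ) * ∏ i, p (w i) := by
        refine sum_le_sum fun w h => ?_
        rw [mul_comm]
        exact mul_le_mul_of_nonneg_right (mem_filter.mp h).2.le (hw w)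
    _ ≤ ∑ w : Fin T → κ, (#{i | P (w i)} : ℝ) * ∏ i, p (w i) :=
        sum_le_sum_of_subset_of_nonneg (filter_subset _ _) fun w _ _ =>
          mul_nonneg (Nat.cast_nonneg _) (hw w)
    _ = ∑ w : Fin T → κ, ∑ i : Fin T, if P (w i) then ∏ j, p (w j) else 0 := by
        refine sum_congr rfl fun w _ => ?_
        rw [← sum_filter, sum_const, nsmul_eq_mul]
    _ = T * ∑ l with P l, p l := by
        rw [sum_comm]
        simp_rw [mean]
        simp

end Tensor

/-! ### Identifying a bit string from signed components. -/

/-- The sign `(-1)^{b_i}` attached to a letter `i`; the blank letter has sign `1`. -/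
def letterSign {d : ℕ} (b : Fin d → Bool) : Option (Fin d) → ℂ
  | none => 1
  | some i => if b i then -1 else 1

theorem norm_letterSign {d : ℕ} (b : Fin d → Bool) (o : Option (Fin d)) :
    ‖letterSign b o‖ = 1 := by
  cases o with
  | none => simp [letterSign]
  | some i => simp only [letterSign]; split_ifs <;> simp

/-- The indices that occur an odd number of times in a word. -/
def oddSupport {d T : ℕ} (w : Fin T → Option (Fin d)) : Finset (Fin d) :=
  univ.filter fun i => Odd #{t | w t = some i}

/-- Signs square to `1`, so only the parity of each letter's multiplicity matters. Words with the
same odd support can therefore be merged. -/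
theorem prod_letterSign {d T : ℕ} (b : Fin d → Bool) (w : Fin T → Option (Fin d)) :
    ∏ t, letterSign b (w t) = ∏ i ∈ oddSupport w, letterSign b (some i) := by
  rw [← prod_fiberwise univ w fun t => letterSign b (w t), Fintype.prod_option]
  have h0 : ∏ t with w t = none, letterSign b (w t) = 1 :=
    prod_eq_one fun t ht => by rw [(mem_filter.mp ht).2]; rfl
  rw [h0, one_mul, oddSupport, prod_filter]
  refine prod_congr rfl fun i _ => ?_
  rw [prod_congr rfl (g := fun _ => letterSign b (some i))
    fun t ht => by rw [(mem_filter.mp ht).2], prod_const]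
  simp only [letterSign]
  split_ifs with hb ho ho
  · exact ho.neg_one_pow
  · exact (Nat.not_odd_iff_even.mp ho).neg_one_pow
  · simp
  · simp

theorem card_oddSupport_le {d T : ℕ} (w : Fin T → Option (Fin d)) :
    #(oddSupport w) ≤ #{t | (w t).isSome} := by
  have h : (oddSupport w).map Function.Embedding.some ⊆ image w {t | (w t).isSome} := by
    intro o ho
    obtain ⟨i, hi, rfl⟩ := mem_map.mp ho
    have hpos := (mem_filter.mp hi).2.pos
    obtain ⟨t, ht⟩ := card_pos.mp hpos
    have ht' := (mem_filter.mp ht).2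
    exact mem_image.mpr ⟨t, mem_filter.mpr ⟨mem_univ _, by rw [ht']; rfl⟩, ht'⟩
  rw [← card_map Function.Embedding.some]
  exact (card_le_card h).trans card_image_le

/-- The subsets of `Fin d` with at most `d / 20` elements. -/
def smallSubsets (d : ℕ) : Finset (Finset (Fin d)) :=
  univ.filter fun S => 20 * #S ≤ d

/-- Average success of a measurement that has to identify a bit string `b` up to a small set of
errors from `T` copies of the state `∑ l, ± e l`, the signs being those of `b` at the active
letters `l`. -/
theorem sum_sum_prob_le {ι κ : Type*} [Fintype ι] [DecidableEq ι] [Fintype κ] {d T m : ℕ}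
    (hd : 0 < d) {e : κ → ι → ℂ} {p : κ → ℝ}
    (he : ∀ l l', l ≠ l' → ∑ z, star (e l z) * e l' z = 0)
    (hp : ∀ l, ∑ z, ‖e l z‖ ^ 2 = p l) (hp1 : ∑ l, p l = 1) (act : κ → Option (Fin d))
    (M : POVM (Fin T → ι) m) (good : (Fin d → Bool) → Fin m → Prop) [∀ b, DecidablePred (good b)]
    (hgood : ∀ j, #{b | good b j} ≤ #(smallSubsets d)) :
    ∑ b, ∑ j with good b j,
        M.prob (density (tensorPower T (∑ l, letterSign b (act l) • e l))) j
      ≤ 2 * (#(smallSubsets d) : ℝ) ^ 2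
        + 2 * 2 ^ d * (T * (∑ l with (act l).isSome, p l) / (d / 20)) := by
  classical
  obtain ⟨B, hB, hBI⟩ := M.exists_measurementOperators
  have hp0 : ∀ l, 0 ≤ p l := fun l => by rw [← hp]; positivity
  have hW0 : ∀ w : Fin T → κ, 0 ≤ ∏ i, p (w i) := fun w => prod_nonneg fun i _ => hp0 _
  set E : (Fin T → κ) → (Fin T → ι) → ℂ := fun w z => ∏ i, e (w i) (z i) with hE
  set long : Finset (Fin T → κ) :=
    univ.filter fun w => (d : ℝ) / 20 < #{i | (act (w i)).isSome} with hlong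
  set F := smallSubsets d with hF
  set S : (Fin T → κ) → Finset (Fin d) := fun w => oddSupport fun i => act (w i) with hS
  -- The short words grouped by odd support. These vectors do not depend on `b`, which enters only
  -- through the coefficients `chi b s`.
  set u : Finset (Fin d) → (Fin T → ι) → ℂ :=
    fun s => ∑ w ∈ longᶜ with S w = s, (1 : ℂ) • E w with hu
  set tail : (Fin d → Bool) → (Fin T → ι) → ℂ :=
    fun b => ∑ w ∈ long, (∏ i, letterSign b (act (w i))) • E w with htail
  set chi : (Fin d → Bool) → Finset (Fin d) → ℂ :=
    fun b s => ∏ i ∈ s, letterSign b (some i) with hchi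
  have hmaps : ∀ w ∈ longᶜ, S w ∈ F := by
    intro w hw
    simp only [hlong, compl_filter, mem_filter, mem_univ, true_and, not_lt] at hw
    have h1 := card_oddSupport_le fun i => act (w i)
    have h2 : ((#(S w) : ℕ) : ℝ) ≤ d / 20 := le_trans (by exact_mod_cast h1) hw
    refine mem_filter.mpr ⟨mem_univ _, ?_⟩
    have : (20 : ℝ) * #(S w) ≤ d := by linarith
    exact_mod_cast this
  have hdec : ∀ b, tensorPower T (∑ l, letterSign b (act l) • e l)
      = (∑ s ∈ F, chi b s • u s) + tail b := by
    intro b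
    rw [tensorPower_sum, ← sum_add_sum_compl long, add_comm]
    congr 1
    rw [← sum_fiberwise_of_maps_to hmaps]
    refine sum_congr rfl fun s _ => ?_
    rw [hu, smul_sum]
    refine sum_congr rfl fun w hw => ?_
    rw [one_smul, prod_letterSign b fun i => act (w i), ← (mem_filter.mp hw).2]
  have htailnorm : ∀ b, ∑ z, ‖tail b z‖ ^ 2
      ≤ T * (∑ l with (act l).isSome, p l) / (d / 20) := by
    intro b
    rw [htail, sum_norm_sq_sum_prod he hp long _
      fun w => by rw [norm_prod]; exact prod_eq_one fun i _ => norm_letterSign b _]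
    exact sum_prod_filter_le hp0 hp1 (fun l => (act l).isSome) (by positivity)
  have hmain : ∑ s ∈ F, ∑ z, ‖u s z‖ ^ 2 ≤ 1 := by
    have h1 : ∀ s, ∑ z, ‖u s z‖ ^ 2 = ∑ w ∈ longᶜ with S w = s, ∏ i, p (w i) := fun s =>
      sum_norm_sq_sum_prod he hp _ _ fun _ => norm_one
    simp_rw [h1]
    rw [sum_fiberwise_of_maps_to hmaps]
    refine (sum_le_sum_of_subset_of_nonneg (subset_univ _) fun w _ _ => hW0 w).trans_eq ?_
    rw [← Fintype.piFinset_univ, ← prod_univ_sum (fun _ => univ) fun _ l => p l]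
    simp [hp1]
  have hbound : ∀ b j, M.prob (density (tensorPower T (∑ l, letterSign b (act l) • e l))) j
      ≤ 2 * (#F * ∑ s ∈ F, ∑ k, ‖(B j).mulVec (u s) k‖ ^ 2)
        + 2 * ∑ k, ‖(B j).mulVec (tail b) k‖ ^ 2 := by
    intro b j
    rw [hB, hdec]
    refine (sum_norm_sq_mulVec_add_le _ _ _).trans ?_
    have := sum_norm_sq_mulVec_sum_le (B j) F (chi b)
      (fun s => by rw [norm_prod]; exact prod_eq_one fun i _ => norm_letterSign b _) u
    linarith
  set Q : Fin m → ℝ := fun j => ∑ s ∈ F, ∑ k, ‖(B j).mulVec (u s) k‖ ^ 2 with hQ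
  have hQ0 : ∀ j, 0 ≤ Q j := fun j => by positivity
  have hQsum : ∑ j, Q j ≤ 1 := by
    rw [hQ, sum_comm]
    simp_rw [sum_norm_sq_of_sum_star_mul hBI]
    exact hmain
  calc _ ≤ ∑ b, ∑ j with good b j, (2 * (#F * Q j)
        + 2 * ∑ k, ‖(B j).mulVec (tail b) k‖ ^ 2) :=
        sum_le_sum fun b _ => sum_le_sum fun j _ => hbound b j
    _ = ∑ b, ∑ j with good b j, 2 * (#F * Q j)
        + ∑ b, ∑ j with good b j, 2 * ∑ k, ‖(B j).mulVec (tail b) k‖ ^ 2 := by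
        simp_rw [sum_add_distrib]
    _ ≤ _ := ?_
  refine add_le_add ?_ ?_
  -- `Q j` is free of `b`, so after exchanging the sums each outcome is counted at most `#F` times,
  -- by `hgood`.
  · simp_rw [sum_filter]
    rw [sum_comm]
    simp_rw [← sum_filter, sum_const, nsmul_eq_mul]
    calc ∑ j, (#{b | good b j} : ℝ) * (2 * (#F * Q j))
        ≤ ∑ j, (#F : ℝ) * (2 * (#F * Q j)) := by
          refine sum_le_sum fun j _ => mul_le_mul_of_nonneg_right ?_ ?_
          · exact_mod_cast hgood j
          · have := hQ0 j; positivity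
      _ = 2 * (#F : ℝ) ^ 2 * ∑ j, Q j := by
          rw [mul_sum]; exact sum_congr rfl fun j _ => by ring
      _ ≤ 2 * (#F : ℝ) ^ 2 := mul_le_of_le_one_right (by positivity) hQsum
  · calc ∑ b, ∑ j with good b j, 2 * ∑ k, ‖(B j).mulVec (tail b) k‖ ^ 2
        ≤ ∑ b, ∑ j, 2 * ∑ k, ‖(B j).mulVec (tail b) k‖ ^ 2 :=
          sum_le_sum fun b _ => sum_le_sum_of_subset_of_nonneg (subset_univ _)
            fun j _ _ => by positivity
      _ ≤ ∑ _b : Fin d → Bool, 2 * (T * (∑ l with (act l).isSome, p l) / (d / 20)) := by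
          refine sum_le_sum fun b _ => ?_
          rw [← mul_sum, sum_norm_sq_of_sum_star_mul hBI]
          exact mul_le_mul_of_nonneg_left (htailnorm b) (by norm_num)
      _ = _ := by simp; ring

/-- Chernoff bound for the number of small subsets. -/
theorem eight_mul_card_smallSubsets_sq_le {d : ℕ} (hd : 8 ≤ d) :
    8 * (#(smallSubsets d) : ℝ) ^ 2 ≤ 2 ^ d := by
  -- Exponential Markov with base `x = (7/8)^20`: for `20 * #s ≤ d` one has `(7/8)^d ≤ x ^ #s`, and
  -- `x ^ #s` summed over all subsets is `(1 + x)^d`. The base works because `(1 + x)^2 ≤ 3/2 *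
  -- (7/8)^2`.
  have h1 : (#(smallSubsets d) : ℝ) * (7 / 8) ^ d ≤ (1 + (7 / 8) ^ 20) ^ d := by
    calc (#(smallSubsets d) : ℝ) * (7 / 8) ^ d
        = ∑ _s ∈ smallSubsets d, (7 / 8 : ℝ) ^ d := by rw [sum_const, nsmul_eq_mul]
      _ ≤ ∑ s ∈ smallSubsets d, ((7 / 8 : ℝ) ^ 20) ^ #s := by
          refine sum_le_sum fun s hs => ?_
          rw [← pow_mul]
          exact pow_le_pow_of_le_one (by norm_num) (by norm_num) (mem_filter.mp hs).2
      _ ≤ ∑ s : Finset (Fin d), ((7 / 8 : ℝ) ^ 20) ^ #s :=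
          sum_le_sum_of_subset_of_nonneg (subset_univ _) fun _ _ _ => by positivity
      _ = (1 + (7 / 8) ^ 20) ^ d := by
          have := Fintype.sum_pow_mul_eq_add_pow (Fin d) ((7 / 8 : ℝ) ^ 20) 1
          simpa only [one_pow, mul_one, Fintype.card_fin, add_comm] using this
  have h2 : (#(smallSubsets d) : ℝ) ^ 2 * ((7 / 8) ^ 2) ^ d ≤ (3 / 2) ^ d * ((7 / 8) ^ 2) ^ d := by
    calc (#(smallSubsets d) : ℝ) ^ 2 * ((7 / 8) ^ 2) ^ d
        = (#(smallSubsets d) * (7 / 8) ^ d) ^ 2 := by rw [mul_pow, ← pow_mul, ← pow_mul, mul_comm d]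
      _ ≤ ((1 + (7 / 8) ^ 20) ^ d) ^ 2 := pow_le_pow_left₀ (by positivity) h1 2
      _ = ((1 + (7 / 8) ^ 20) ^ 2) ^ d := by rw [← pow_mul, ← pow_mul, mul_comm]
      _ ≤ (3 / 2 * (7 / 8) ^ 2) ^ d := pow_le_pow_left₀ (by positivity) (by norm_num) d
      _ = _ := mul_pow _ _ _
  have h3 : (#(smallSubsets d) : ℝ) ^ 2 ≤ (3 / 2) ^ d := le_of_mul_le_mul_right h2 (by positivity)
  -- This is where `d ≥ 8` is needed.
  have h4 : (8 : ℝ) ≤ (4 / 3) ^ d :=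
    le_trans (by norm_num) (pow_le_pow_right₀ (by norm_num : (1 : ℝ) ≤ 4 / 3) hd)
  calc 8 * (#(smallSubsets d) : ℝ) ^ 2 ≤ (4 / 3) ^ d * (3 / 2) ^ d := by gcongr
    _ = 2 ^ d := by rw [← mul_pow]; norm_num

/-- Hamming balls of radius `d / 20` are no larger than the family of small subsets. -/
theorem card_filter_le_card_smallSubsets {d : ℕ} (P : (Fin d → Bool) → Prop) [DecidablePred P]
    (y : Fin d → Bool) (hP : ∀ b, P b → 20 * #{i | y i ≠ b i} ≤ d) :
    #{b | P b} ≤ #(smallSubsets d) := by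
  refine card_le_card_of_injOn (fun b => univ.filter fun i => y i ≠ b i) (fun b hb => ?_) ?_
  · exact mem_filter.mpr ⟨mem_univ _, hP b (by simpa using hb)⟩
  · intro b _ b' _ h
    ext i
    have := Finset.ext_iff.mp h i
    simp only [mem_filter, mem_univ, true_and] at this
    revert this
    cases y i <;> cases b i <;> cases b' i <;> simp

/-! ### Shattered points and distributions supported on them. -/

theorem exists_injective_of_vcDim_eq {n d : ℕ} {C : Finset (Concept n)} (h : vcDim C = d + 1) :
    ∃ e : Fin (d + 1) → Input n, Function.Injective e ∧
      ∀ f : Fin (d + 1) → Bool, ∃ c ∈ C, ∀ k, c (e k) = f k := by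
  classical
  rw [vcDim, Finset.vcDim] at h
  have hne : (C.image fun c => univ.filter fun x => c x = true).shatterer.Nonempty := by
    -- The supremum over an empty shatterer would be `0`, which is not `d + 1`.
    by_contra hE
    rw [not_nonempty_iff_eq_empty.mp hE, sup_empty] at h
    exact absurd h (by simp)
  obtain ⟨s, hs, hsup⟩ := exists_mem_eq_sup _ hne card
  rw [h] at hsup
  rw [mem_shatterer] at hs
  let E : Fin (d + 1) ≃ s := (s.equivFinOfCardEq hsup.symm).symm
  have hinj : Function.Injective fun k => (E k : Input n) :=
    Subtype.val_injective.comp E.injective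
  refine ⟨fun k => E k, hinj, fun f => ?_⟩
  have hsub : (univ.filter fun k => f k = true).image (fun k => (E k : Input n)) ⊆ s := by
    intro x hx
    obtain ⟨k, _, rfl⟩ := mem_image.mp hx
    exact (E k).2
  obtain ⟨v, hv, hsv⟩ := hs hsub
  obtain ⟨c, hc, rfl⟩ := mem_image.mp hv
  refine ⟨c, hc, fun k => ?_⟩
  have hk := Finset.ext_iff.mp hsv (E k)
  rw [mem_inter, mem_filter, hinj.mem_finset_image, mem_filter] at hk
  simp only [(E k).2, mem_univ, true_and] at hk
  exact Bool.eq_iff_iff.mpr hk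

/-- The distribution that puts weight `wt k` on the point `e k`. -/
def pointWeights {n : ℕ} {β : Type*} [Fintype β] (e : β → Input n) (wt : β → ℝ) :
    Input n → ℝ :=
  fun x => ∑ k, if e k = x then wt k else 0

section PointWeights

variable {n : ℕ} {β : Type*} [Fintype β] {e : β → Input n} {wt : β → ℝ}

theorem sum_pointWeights_mul (f : Input n → ℝ) :
    ∑ x, pointWeights e wt x * f x = ∑ k, wt k * f (e k) := by
  simp only [pointWeights, sum_mul]
  rw [sum_comm]
  simp

theorem pointWeights_mem_stdSimplex (hwt : wt ∈ stdSimplex ℝ β) :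
    pointWeights e wt ∈ stdSimplex ℝ (Input n) := by
  refine ⟨fun x => sum_nonneg fun k _ => ?_, ?_⟩
  · split_ifs
    · exact hwt.1 k
    · exact le_rfl
  · have := sum_pointWeights_mul (e := e) (wt := wt) fun _ => 1
    simpa [hwt.2] using this

theorem pointWeights_apply (he : Function.Injective e) (k : β) :
    pointWeights e wt (e k) = wt k := by
  classical
  simp [pointWeights, he.eq_iff]

theorem pointWeights_eq_zero {x : Input n} (hx : ∀ k, e k ≠ x) : pointWeights e wt x = 0 := by
  simp [pointWeights, hx]

theorem err_pointWeights (h c : Concept n) :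
    err (pointWeights e wt) h c = ∑ k with h (e k) ≠ c (e k), wt k := by
  have := sum_pointWeights_mul (e := e) (wt := wt) fun x => if h x ≠ c x then 1 else 0
  simpa only [err, sum_filter, mul_ite, mul_one, mul_zero] using this

end PointWeights

/-! ### Overlaps of noisy examples. -/

section Overlap

variable {n : ℕ} {η : ℝ} {D : Input n → ℝ}

/-- Where the concepts agree the label qubits coincide. Where they disagree the amplitudes `√(1-η)`
and `√η` are swapped. -/
theorem sum_star_noisyExample_mul (hη : 0 ≤ η) (hη1 : η ≤ 1) (hD : ∀ x, 0 ≤ D x)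
    (c c' : Concept n) :
    ∑ z, star (noisyExample η D c z) * noisyExample η D c' z
      = ((∑ x, D x * (if c x = c' x then 1 else 2 * √(η * (1 - η))) : ℝ) : ℂ) := by
  rw [Fintype.sum_prod_type, Complex.ofReal_sum]
  refine sum_congr rfl fun x _ => ?_
  rw [Fintype.sum_bool]
  have h1 : √((1 - η) * D x) * √((1 - η) * D x) = (1 - η) * D x :=
    Real.mul_self_sqrt (mul_nonneg (by linarith) (hD x))
  have h2 : √(η * D x) * √(η * D x) = η * D x := Real.mul_self_sqrt (mul_nonneg hη (hD x))
  have h3 : √((1 - η) * D x) * √(η * D x) = D x * √(η * (1 - η)) := by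
    rw [← Real.sqrt_mul (mul_nonneg (by linarith) (hD x)),
      show (1 - η) * D x * (η * D x) = (D x) ^ 2 * (η * (1 - η)) by ring,
      Real.sqrt_mul (sq_nonneg _), Real.sqrt_sq (hD x)]
  cases hc : c x <;> cases hc' : c' x <;>
    simp only [noisyExample, hc, hc', Complex.star_def, Complex.conj_ofReal, reduceCtorEq,
      if_true, if_false, ← Complex.ofReal_mul, ← Complex.ofReal_add, Complex.ofReal_inj] <;>
    linarith

theorem sum_norm_sq_noisyExample (hη : 0 ≤ η) (hη1 : η ≤ 1) (hD : D ∈ stdSimplex ℝ (Input n))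
    (c : Concept n) : ∑ z, ‖noisyExample η D c z‖ ^ 2 = 1 := by
  have h := sum_star_noisyExample_mul hη hη1 hD.1 c c
  simp only [if_true, mul_one, hD.2, Complex.star_def, Complex.conj_mul'] at h
  exact_mod_cast h

/-- With `s = √(η(1-η))` the left side is `4s²`, and `s ≤ 1/2`. Both halves of the theorem get their
factor `(1-2η)²` from here. -/
theorem one_sub_sq_le_two_mul_sqrt (hη : 0 ≤ η) (hη1 : η ≤ 1) :
    1 - (1 - 2 * η) ^ 2 ≤ 2 * √(η * (1 - η)) := by
  have hnn : 0 ≤ η * (1 - η) := mul_nonneg hη (by linarith)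
  have hs := Real.sq_sqrt hnn
  have h0 := Real.sqrt_nonneg (η * (1 - η))
  have h1 : √(η * (1 - η)) ≤ 1 / 2 := by
    rw [Real.sqrt_le_left (by norm_num)]
    nlinarith [sq_nonneg (1 - 2 * η)]
  nlinarith

theorem one_sub_le_norm_overlap (hη : 0 ≤ η) (hη1 : η ≤ 1) (hD : D ∈ stdSimplex ℝ (Input n))
    (c c' : Concept n) :
    1 - (1 - 2 * η) ^ 2 * err D c c'
      ≤ ‖∑ z, star (noisyExample η D c z) * noisyExample η D c' z‖ := by
  rw [sum_star_noisyExample_mul hη hη1 hD.1, Complex.norm_real]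
  refine le_trans ?_ (le_abs_self _)
  have h1 : 1 - (1 - 2 * η) ^ 2 * err D c c' = ∑ x, D x - (1 - 2 * η) ^ 2 * err D c c' := by
    rw [hD.2]
  rw [h1, err, sum_filter, mul_sum, ← sum_sub_distrib]
  refine sum_le_sum fun x _ => ?_
  have hx := hD.1 x
  by_cases h : c x = c' x
  · simp [h]
  · simp only [ne_eq, h, not_false_eq_true, if_true, if_false]
    nlinarith [one_sub_sq_le_two_mul_sqrt hη hη1]

end Overlap

/-! ### The confidence term. -/

section Confidence

variable {n : ℕ}

theorem Learner.numExamples_le_sampleComplexity (L : Learner n) {r : Fin L.numSeeds}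
    (hr : 0 < L.seedProb r) : L.numExamples r ≤ L.sampleComplexity :=
  le_sup (f := L.numExamples) (mem_filter.mpr ⟨mem_univ _, hr⟩)

/-- A learner that succeeds on two concepts no hypothesis can approximate simultaneously. -/
theorem Learner.IsNoisyPAC.one_sub_pow_le {C : Finset (Concept n)} {ε δ η : ℝ} {L : Learner n}
    (hL : L.IsNoisyPAC C ε δ η) (hδ : 0 < δ) (hη : 0 ≤ η) (hη1 : η ≤ 1) {D : Input n → ℝ}
    (hD : D ∈ stdSimplex ℝ (Input n)) {c c' : Concept n} (hc : c ∈ C) (hc' : c' ∈ C)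
    (hsep : ∀ h : Concept n, err D h c ≤ ε → ¬ err D h c' ≤ ε)
    (hle : 0 ≤ 1 - (1 - 2 * η) ^ 2 * err D c c') :
    (1 - (1 - 2 * η) ^ 2 * err D c c') ^ L.sampleComplexity ≤ 2 * √δ := by
  classical
  set q := 1 - (1 - 2 * η) ^ 2 * err D c c' with hq
  have ht : 0 < √δ := Real.sqrt_pos.mpr hδ
  have hq1 : q ≤ 1 := by
    have : 0 ≤ err D c c' := sum_nonneg fun x _ => hD.1 x
    have := mul_nonneg (sq_nonneg (1 - 2 * η)) this
    linarith
  set A : (c : Concept n) → Fin L.numSeeds → ℝ := fun c r =>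
    ∑ j with err D (L.hypothesis r j) c ≤ ε,
      (L.povm r).prob (density (tensorPower (L.numExamples r) (noisyExample η D c))) j with hA
  have h1 : 1 - δ ≤ ∑ r, L.seedProb r * A c r := hL c hc D hD
  have h2 : 1 - δ ≤ ∑ r, L.seedProb r * A c' r := hL c' hc' D hD
  have hsum := L.seedProb_mem.2
  have hr : ∀ r, L.seedProb r * q ^ L.sampleComplexity
      ≤ L.seedProb r * (√δ + ((1 - A c r) + (1 - A c' r)) / (2 * √δ)) := by
    intro r
    -- The sample complexity does not bound the examples used by seeds of probability `0`, so these
    -- are set aside.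
    rcases (L.seedProb_mem.1 r).eq_or_lt with h0 | h0
    · simp [← h0]
    refine mul_le_mul_of_nonneg_left ?_ h0.le
    have hbd := (L.povm r).norm_overlap_le
      (sum_norm_sq_tensorPower (T := L.numExamples r) (sum_norm_sq_noisyExample hη hη1 hD c))
      (sum_norm_sq_tensorPower (T := L.numExamples r) (sum_norm_sq_noisyExample hη hη1 hD c'))
      (A := univ.filter fun j => err D (L.hypothesis r j) c ≤ ε)
      (A' := univ.filter fun j => err D (L.hypothesis r j) c' ≤ ε)
      (disjoint_filter.mpr fun j _ => hsep _) ht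
    refine le_trans ?_ hbd
    rw [sum_star_tensorPower_mul, norm_pow]
    exact (pow_le_pow_of_le_one hle hq1 (L.numExamples_le_sampleComplexity h0)).trans
      (pow_le_pow_left₀ hle (one_sub_le_norm_overlap hη hη1 hD c c') _)
  have hmean := sum_le_sum fun r (_ : r ∈ univ) => hr r
  rw [← sum_mul, hsum, one_mul] at hmean
  refine hmean.trans ?_
  have e1 : ∑ r, L.seedProb r * (√δ + ((1 - A c r) + (1 - A c' r)) / (2 * √δ))
      = (∑ r, L.seedProb r) * √δ + (2 * (∑ r, L.seedProb r) - ∑ r, L.seedProb r * A c r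
        - ∑ r, L.seedProb r * A c' r) / (2 * √δ) := by
    rw [sum_mul, mul_sum, ← sum_sub_distrib, ← sum_sub_distrib, sum_div, ← sum_add_distrib]
    exact sum_congr rfl fun r _ => by ring
  rw [e1, hsum]
  -- The total error is at most `2δ`, so `t = √δ` balances the two terms of the overlap bound.
  have e2 : (2 * 1 - ∑ r, L.seedProb r * A c r - ∑ r, L.seedProb r * A c' r) / (2 * √δ)
      ≤ √δ := by
    rw [div_le_iff₀ (by positivity)]
    nlinarith [Real.mul_self_sqrt hδ.le]
  linarith

/-- The dependence of the sample complexity on the confidence, for classes that shatter two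
points. -/
theorem Learner.IsNoisyPAC.log_le {d : ℕ} {C : Finset (Concept n)} {ε δ η : ℝ} {L : Learner n}
    (hL : L.IsNoisyPAC C ε δ η) (hδ : 0 < δ) (hδ1 : δ ≤ 1 / 16) (hε : 0 < ε) (hε1 : ε ≤ 1 / 20)
    (hη : 0 < η) (hη1 : η < 1 / 2) (hd : 0 < d) {e : Fin (d + 1) → Input n}
    (hshat : ∀ f : Fin (d + 1) → Bool, ∃ c ∈ C, ∀ k, c (e k) = f k) :
    Real.log (1 / δ) ≤ 16 * ((1 - 2 * η) ^ 2 * ε) * L.sampleComplexity := by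
  have hlast : Fin.last d ≠ 0 := by
    intro h
    have := congrArg Fin.val h
    simp at this
    omega
  set wt : Fin (d + 1) → ℝ := fun k =>
    (if k = 0 then 1 - 2 * ε else 0) + (if k = Fin.last d then 2 * ε else 0) with hwt
  have hwtmem : wt ∈ stdSimplex ℝ (Fin (d + 1)) := by
    refine ⟨fun k => add_nonneg ?_ ?_, ?_⟩
    · split_ifs <;> linarith
    · split_ifs <;> linarith
    · simp [hwt, sum_add_distrib]
  have hwl : wt (Fin.last d) = 2 * ε := by simp [hwt, hlast]
  obtain ⟨c, hc, hcf⟩ := hshat fun _ => false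
  obtain ⟨c', hc', hcf'⟩ := hshat fun k => decide (k = Fin.last d)
  have hD := pointWeights_mem_stdSimplex (e := e) hwtmem
  have hwrong : ∀ h g : Concept n, h (e (Fin.last d)) ≠ g (e (Fin.last d)) →
      ε < err (pointWeights e wt) h g := by
    intro h g hne
    rw [err_pointWeights]
    have := single_le_sum (f := wt) (s := univ.filter fun k => h (e k) ≠ g (e k))
      (fun k _ => hwtmem.1 k) (mem_filter.mpr ⟨mem_univ (Fin.last d), hne⟩)
    linarith
  have hsep : ∀ h : Concept n, err (pointWeights e wt) h c ≤ ε →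
      ¬ err (pointWeights e wt) h c' ≤ ε := by
    intro h h1 h2
    have e1 := not_imp_comm.mp (hwrong h c) (not_lt.mpr h1)
    have e2 := not_imp_comm.mp (hwrong h c') (not_lt.mpr h2)
    rw [e1, hcf, hcf'] at e2
    simp at e2
  have herr : err (pointWeights e wt) c c' = 2 * ε := by
    rw [err_pointWeights, sum_eq_single (Fin.last d)]
    · exact hwl
    · intro k hk hne
      rw [mem_filter, hcf, hcf'] at hk
      simp [hne] at hk
    · intro hk
      rw [mem_filter, hcf, hcf'] at hk
      simp at hk
  have hu0 : 0 < (1 - 2 * η) ^ 2 := by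
    have : 0 < 1 - 2 * η := by linarith
    positivity
  have hu1 : (1 - 2 * η) ^ 2 ≤ 1 := by nlinarith
  set u := (1 - 2 * η) ^ 2 with hu
  have hx : u * (2 * ε) ≤ 1 / 10 := by nlinarith
  have hx0 : 0 < u * (2 * ε) := by positivity
  have hpow := hL.one_sub_pow_le hδ hη.le (by linarith) hD hc hc' hsep
    (by rw [herr]; linarith)
  rw [herr] at hpow
  have hlogx : -(2 * (u * (2 * ε))) ≤ Real.log (1 - u * (2 * ε)) := by
    have h1 := Real.one_sub_inv_le_log_of_pos (show 0 < 1 - u * (2 * ε) by linarith)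
    refine le_trans ?_ h1
    have h2 : (1 - u * (2 * ε))⁻¹ ≤ 1 + 2 * (u * (2 * ε)) := by
      rw [inv_le_iff_one_le_mul₀ (by linarith)]
      nlinarith
    linarith
  have hlog := Real.log_le_log (pow_pos (by linarith) _) hpow
  rw [Real.log_pow, Real.log_mul (by norm_num) (Real.sqrt_pos.mpr hδ).ne',
    Real.log_sqrt hδ.le] at hlog
  have hT := mul_le_mul_of_nonneg_left hlogx (Nat.cast_nonneg (α := ℝ) L.sampleComplexity)
  -- For `δ ≤ 1/16` the loss `log 2` from the factor in `2√δ` is at most half of `log (1/δ) / 2`.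
  have h16 : 4 * Real.log 2 ≤ Real.log (1 / δ) := by
    have : Real.log ((2 : ℝ) ^ 4) ≤ Real.log (1 / δ) := by
      refine Real.log_le_log (by norm_num) ?_
      rw [le_div_iff₀ hδ]
      linarith
    rwa [Real.log_pow] at this
  rw [one_div, Real.log_inv] at h16 ⊢
  linarith

end Confidence

/-! ### The dimension term. -/

section Letters

variable {n d : ℕ}

/-- The components of a noisy example at the point `e k` in the rotated basis
`|0⟩ + |1⟩, |0⟩ - |1⟩` of the label qubit. -/
noncomputable def letterVec (η : ℝ) (e : Fin (d + 1) → Input n) (wt : Fin (d + 1) → ℝ) :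
    Fin (d + 1) × Bool → Example n → ℂ
  | (k, false), z => if e k = z.1 then ((√(wt k) * ((√(1 - η) + √η) / 2) : ℝ) : ℂ) else 0
  | (k, true), z => if e k = z.1 then
      ((√(wt k) * ((√(1 - η) - √η) / 2) * (if z.2 then -1 else 1) : ℝ) : ℂ) else 0

/-- Squared norms of the components of a noisy example. -/
noncomputable def letterProb (η : ℝ) (wt : Fin (d + 1) → ℝ) : Fin (d + 1) × Bool → ℝ
  | (k, false) => wt k * ((√(1 - η) + √η) ^ 2 / 2)
  | (k, true) => wt k * ((√(1 - η) - √η) ^ 2 / 2)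

/-- The unknown bit that decides the sign of a component. -/
def letterIndex : Fin (d + 1) × Bool → Option (Fin d)
  | (_, false) => none
  | (k, true) => Fin.cases none some k

variable {η : ℝ} {e : Fin (d + 1) → Input n} {wt : Fin (d + 1) → ℝ}

theorem sum_star_letterVec_mul (he : Function.Injective e) (l l' : Fin (d + 1) × Bool)
    (h : l ≠ l') : ∑ z, star (letterVec η e wt l z) * letterVec η e wt l' z = 0 := by
  obtain ⟨k, τ⟩ := l
  obtain ⟨k', τ'⟩ := l'
  by_cases hk : k = k'
  · subst hk
    rw [Fintype.sum_prod_type]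
    refine sum_eq_zero fun x _ => ?_
    rw [Fintype.sum_bool]
    by_cases hx : e k = x
    · cases τ <;> cases τ' <;> first | exact absurd rfl h | simp [letterVec, hx]
    · cases τ <;> cases τ' <;> simp [letterVec, hx]
  · refine sum_eq_zero fun z _ => ?_
    by_cases hx : e k = z.1
    · have hx' : e k' ≠ z.1 := fun hx' => hk (he (hx.trans hx'.symm))
      have : letterVec η e wt (k', τ') z = 0 := by cases τ' <;> simp [letterVec, hx']
      rw [this, mul_zero]
    · have : letterVec η e wt (k, τ) z = 0 := by cases τ <;> simp [letterVec, hx]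
      rw [this, star_zero, zero_mul]

theorem sum_norm_sq_letterVec (hwt : ∀ k, 0 ≤ wt k) (l : Fin (d + 1) × Bool) :
    ∑ z, ‖letterVec η e wt l z‖ ^ 2 = letterProb η wt l := by
  obtain ⟨k, τ⟩ := l
  have hs := Real.sq_sqrt (hwt k)
  rw [Fintype.sum_prod_type, sum_eq_single (e k)]
  · rw [Fintype.sum_bool]
    cases τ <;> simp only [letterVec, letterProb, if_true, Complex.norm_real, Real.norm_eq_abs,
      sq_abs, mul_pow, hs, Bool.false_eq_true, if_false] <;> ring
  · intro x _ hx
    refine sum_eq_zero fun β _ => ?_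
    cases τ <;> simp [letterVec, Ne.symm hx]
  · simp

theorem sum_letterProb (hη : 0 ≤ η) (hη1 : η ≤ 1) (hwt : ∑ k, wt k = 1) :
    ∑ l, letterProb η wt l = 1 := by
  rw [Fintype.sum_prod_type]
  simp only [Fintype.sum_bool, letterProb, ← mul_add]
  rw [← sum_mul, hwt, one_mul]
  linarith [Real.sq_sqrt hη, Real.sq_sqrt (show 0 ≤ 1 - η by linarith)]

theorem sum_letterProb_active :
    ∑ l with (letterIndex l).isSome, letterProb η wt l
      = (∑ i : Fin d, wt i.succ) * ((√(1 - η) - √η) ^ 2 / 2) := by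
  rw [sum_filter, Fintype.sum_prod_type, Fin.sum_univ_succ, sum_mul]
  simp [letterIndex, letterProb]

/-- Flipping a label swaps `√(1-η)` and `√η`, which fixes the `|0⟩ + |1⟩` component and negates the
`|0⟩ - |1⟩` one. The point `e 0` has a known label, so its sign is constant and its letters are
blank. -/
theorem noisyExample_pointWeights (he : Function.Injective e)
    (hη : 0 ≤ η) (hη1 : η ≤ 1) {c : Concept n} {b : Fin d → Bool} (h0 : c (e 0) = false)
    (hb : ∀ i : Fin d, c (e i.succ) = b i) :
    noisyExample η (pointWeights e wt) c
      = ∑ l, letterSign b (letterIndex l) • letterVec η e wt l := by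
  have hsign : ∀ k, letterSign b (letterIndex (k, true)) = if c (e k) then -1 else 1 := by
    intro k
    refine Fin.cases ?_ (fun i => ?_) k
    · simp [letterIndex, letterSign, h0]
    · simp [letterIndex, letterSign, hb]
  ext ⟨x, β⟩
  simp only [Finset.sum_apply, Pi.smul_apply, smul_eq_mul, Fintype.sum_prod_type,
    Fintype.sum_bool, hsign]
  by_cases hx : ∃ k, e k = x
  · obtain ⟨k, rfl⟩ := hx
    rw [sum_eq_single k]
    · rw [noisyExample, pointWeights_apply he, Real.sqrt_mul (by linarith), Real.sqrt_mul hη]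
      cases hc : c (e k) <;> cases β <;>
        simp only [letterVec, letterIndex, letterSign, if_true, reduceCtorEq, if_false] <;>
        push_cast <;> ring
    · intro k' _ hne
      have hk : e k' ≠ e k := fun h => hne (he h)
      simp [letterVec, hk]
    · simp
  · push Not at hx
    rw [sum_eq_zero fun k _ => by simp [letterVec, hx k]]
    simp [noisyExample, pointWeights_eq_zero hx]

theorem sq_sqrt_sub_sqrt_le (hη : 0 ≤ η) (hη1 : η ≤ 1) :
    (√(1 - η) - √η) ^ 2 ≤ (1 - 2 * η) ^ 2 := by
  have h := one_sub_sq_le_two_mul_sqrt hη hη1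
  rw [Real.sqrt_mul hη] at h
  linarith [Real.sq_sqrt hη, Real.sq_sqrt (show 0 ≤ 1 - η by linarith)]

/-- The dependence of the sample complexity on the number of shattered points. -/
theorem Learner.IsNoisyPAC.dim_le {C : Finset (Concept n)} {ε δ : ℝ} {L : Learner n}
    (hL : L.IsNoisyPAC C ε δ η) (hδ : δ ≤ 1 / 2) (hε : 0 < ε) (hε1 : ε ≤ 1 / 20)
    (hη : 0 ≤ η) (hη1 : η ≤ 1) (hd : 8 ≤ d) (he : Function.Injective e)
    (hshat : ∀ f : Fin (d + 1) → Bool, ∃ c ∈ C, ∀ k, c (e k) = f k) :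
    (d : ℝ) ≤ 1600 * ((1 - 2 * η) ^ 2 * ε) * L.sampleComplexity := by
  classical
  have hd0 : (0 : ℝ) < d := by exact_mod_cast (show 0 < d by omega)
  -- Each wrong bit costs `20ε/d`, so error at most `ε` allows at most `d/20` wrong bits, the radius
  -- in `smallSubsets`.
  set wt : Fin (d + 1) → ℝ := Fin.cases (1 - 20 * ε) fun _ => 20 * ε / d with hwt
  have hw0 : wt 0 = 1 - 20 * ε := rfl
  have hws : ∀ i : Fin d, wt i.succ = 20 * ε / d := fun _ => rfl
  have hsucc : ∑ i : Fin d, wt i.succ = 20 * ε := by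
    simp only [hws, sum_const, card_univ, Fintype.card_fin, nsmul_eq_mul]
    field_simp
  have hwtmem : wt ∈ stdSimplex ℝ (Fin (d + 1)) := by
    refine ⟨fun k => Fin.cases (by rw [hw0]; linarith) (fun i => ?_) k, ?_⟩
    · rw [Fin.sum_univ_succ, hsucc, hw0]; ring
    · rw [hws]; positivity
  have hD := pointWeights_mem_stdSimplex (e := e) hwtmem
  set D := pointWeights e wt with hDdef
  have hex : ∀ b : Fin d → Bool, ∃ c ∈ C, c (e 0) = false ∧ ∀ i : Fin d, c (e i.succ) = b i := by
    intro b
    obtain ⟨c, hc, hcf⟩ := hshat (Fin.cases false b)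
    exact ⟨c, hc, hcf 0, fun i => hcf i.succ⟩
  choose c hc hc0 hcb using hex
  have hball : ∀ (h : Concept n) (b : Fin d → Bool), err D h (c b) ≤ ε →
      20 * #{i | h (e i.succ) ≠ b i} ≤ d := by
    intro h b hle
    rw [hDdef, err_pointWeights, sum_filter, Fin.sum_univ_succ] at hle
    simp only [hcb, hws] at hle
    rw [← sum_filter, sum_const, nsmul_eq_mul] at hle
    have h1 : 0 ≤ if h (e 0) ≠ c b (e 0) then wt 0 else 0 := by
      split_ifs
      · exact hwtmem.1 0
      · exact le_rfl
    have h2 : (#{i : Fin d | h (e i.succ) ≠ b i} : ℝ) * (20 * ε / d) ≤ ε := by linarith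
    rw [mul_div_assoc', div_le_iff₀ hd0] at h2
    have h3 : ε * (20 * (#{i : Fin d | h (e i.succ) ≠ b i} : ℝ)) ≤ ε * d := by linarith
    exact_mod_cast le_of_mul_le_mul_left h3 hε
  set u := (1 - 2 * η) ^ 2 with hu
  have hbad : (∑ i : Fin d, wt i.succ) * ((√(1 - η) - √η) ^ 2 / 2) ≤ 10 * (u * ε) := by
    rw [hsucc]
    nlinarith [sq_sqrt_sub_sqrt_le hη hη1]
  have hV := eight_mul_card_smallSubsets_sq_le hd
  set N : ℝ := 2 ^ d with hN
  have hN0 : 0 < N := by positivity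
  set S := L.sampleComplexity with hS
  -- `N / 4` comes from `2 * #F ^ 2` and `8 * #F ^ 2 ≤ N`, with `F = smallSubsets d`. The second
  -- term is `2N` times the Markov bound `S * 10uε / (d/20)`.
  set bound : ℝ := N / 4 + 400 * N * (u * ε) * S / d with hbound
  have hseed : ∀ r, L.seedProb r * (∑ b, ∑ j with err D (L.hypothesis r j) (c b) ≤ ε,
      (L.povm r).prob (density (tensorPower (L.numExamples r) (noisyExample η D (c b)))) j)
      ≤ L.seedProb r * bound := by
    intro r
    rcases (L.seedProb_mem.1 r).eq_or_lt with h0 | h0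
    · simp [← h0]
    refine mul_le_mul_of_nonneg_left ?_ h0.le
    have hmain := sum_sum_prob_le (T := L.numExamples r) (show 0 < d by omega)
      (sum_star_letterVec_mul (η := η) (wt := wt) he) (sum_norm_sq_letterVec hwtmem.1)
      (sum_letterProb hη hη1 hwtmem.2) letterIndex (L.povm r)
      (fun b j => err D (L.hypothesis r j) (c b) ≤ ε)
      (fun j => card_filter_le_card_smallSubsets _ (fun i => L.hypothesis r j (e i.succ))
        fun b => hball _ b)
    simp_rw [← noisyExample_pointWeights he hη hη1 (hc0 _) (hcb _)] at hmain
    refine hmain.trans ?_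
    rw [sum_letterProb_active]
    have hT : (L.numExamples r : ℝ) ≤ S := by
      exact_mod_cast L.numExamples_le_sampleComplexity h0
    have hprod : (L.numExamples r : ℝ) * ((∑ i : Fin d, wt i.succ) * ((√(1 - η) - √η) ^ 2 / 2))
        ≤ S * (10 * (u * ε)) := by
      refine mul_le_mul hT hbad ?_ (Nat.cast_nonneg _)
      rw [hsucc]; positivity
    have h2 : 2 * N * ((L.numExamples r : ℝ)
          * ((∑ i : Fin d, wt i.succ) * ((√(1 - η) - √η) ^ 2 / 2)) / (d / 20))
        ≤ 2 * N * (S * (10 * (u * ε)) / (d / 20)) := by gcongr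
    have h3 : 2 * N * (S * (10 * (u * ε)) / (d / 20)) = 400 * N * (u * ε) * S / d := by
      field_simp; ring
    rw [hbound]
    linarith
  have hlower : N * (1 / 2) ≤ ∑ b, L.successProb (noisyExample η D (c b)) D (c b) ε := by
    have h1 : ∑ _b : Fin d → Bool, (1 / 2 : ℝ) = N * (1 / 2) := by simp [hN]
    rw [← h1]
    exact sum_le_sum fun b _ => le_trans (by linarith) (hL (c b) (hc b) D hD)
  have hupper : ∑ b, L.successProb (noisyExample η D (c b)) D (c b) ε ≤ bound := by
    simp only [Learner.successProb]
    rw [sum_comm]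
    simp_rw [← mul_sum]
    refine (sum_le_sum fun r _ => hseed r).trans_eq ?_
    rw [← sum_mul, L.seedProb_mem.2, one_mul]
  have hfin : N * (1 / 4) ≤ N * (400 * (u * ε) * S / d) := by
    have h := hlower.trans hupper
    have h2 : 400 * N * (u * ε) * S / d = N * (400 * (u * ε) * S / d) := by ring
    rw [hbound, h2] at h
    linarith
  have h4 := le_of_mul_le_mul_left hfin hN0
  rw [le_div_iff₀ hd0] at h4
  linarith

end Letters

end QuantumPAC

/-! ### Combining the two terms. -/

theorem mainTheorem6 :
    ∃ K : ℝ, 0 < K ∧ ∃ d₀ : ℕ, ∀ d : ℕ, d₀ ≤ d →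
      ∀ (n : ℕ) (C : Finset (QuantumPAC.Concept n)), QuantumPAC.vcDim C = d + 1 →
      ∀ δ ∈ Set.Ioo (0 : ℝ) (1 / 2), ∀ ε ∈ Set.Ioo (0 : ℝ) (1 / 20),
      ∀ η ∈ Set.Ioo (0 : ℝ) (1 / 2),
      ∀ L : QuantumPAC.Learner n, L.IsNoisyPAC C ε δ η →
        K * ((d : ℝ) / ((1 - 2 * η) ^ 2 * ε)
            + Real.logb 2 (1 / δ) / ((1 - 2 * η) ^ 2 * ε))
          ≤ (L.sampleComplexity : ℝ) := by
  -- Each numerator is at most `1600 * ((1 - 2η)² ε)` times the sample complexity, hence `1/3200`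
  -- for their sum.
  refine ⟨1 / 3200, by norm_num, 8, ?_⟩
  rintro d hd n C hC δ ⟨hδ0, hδ1⟩ ε ⟨hε0, hε1⟩ η ⟨hη0, hη1⟩ L hL
  obtain ⟨e, he, hshat⟩ := QuantumPAC.exists_injective_of_vcDim_eq hC
  have hdim := hL.dim_le hδ1.le hε0 hε1.le hη0.le (by linarith) hd he hshat
  have hw : 0 < (1 - 2 * η) ^ 2 * ε := mul_pos (pow_pos (by linarith) 2) hε0
  have hlog2 : 1 / 2 ≤ Real.log 2 := by linarith [Real.log_two_gt_d9]
  have hlog : Real.logb 2 (1 / δ) ≤ 1600 * ((1 - 2 * η) ^ 2 * ε) * L.sampleComplexity := by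
    rcases le_or_gt δ (1 / 16) with hδ | hδ
    · have h := hL.log_le hδ0 hδ hε0 hε1.le hη0 hη1 (by omega) hshat
      rw [Real.logb, div_le_iff₀ (by linarith)]
      have hS : 0 ≤ (1 - 2 * η) ^ 2 * ε * L.sampleComplexity := by positivity
      nlinarith
    -- For `δ > 1/16` the logarithm is at most `4 ≤ d`, so the dimension bound already covers it.
    · refine le_trans ?_ hdim
      have h4 : Real.logb 2 (1 / δ) ≤ 4 := by
        rw [Real.logb_le_iff_le_rpow (by norm_num) (by positivity), div_le_iff₀ hδ0]
        norm_num
        linarith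
      have hd8 : (8 : ℝ) ≤ d := by exact_mod_cast hd
      linarith
  rw [← add_div, mul_div_assoc', div_le_iff₀ hw]
  linarith
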